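/- Let $b_1,b_2\ge 0$ be integers, not both zero, let $\sigma>0$ and $P'\ge 0$, and let $0=q_0<q_1<\dots<q_{2^{b_2}}=\infty$ be magnitude thresholds. Consider the channel $Z=U+N$ with complex input $U$ and independent circularly symmetric complex Gaussian noise $N$ with $\mathbb{E}|N|^2=\sigma^2$, i.e. with density $\frac{1}{\pi\sigma^2}e^{-|z|^2/\sigma^2}$ on $\mathbb{C}$. The output is the pair $(Y_1,Y_2)$, where $Y_1=y_1\in\{0,\dots,2^{b_1}-1\}$ when the phase of $Z$ (taken in $[-\pi,\pi)$) lies in $\left[\frac{2\pi y_1}{2^{b_1}}-\pi,\frac{2\pi (y_1+1)}{2^{b_1}}-\pi\right)$, and $Y_2=y_2\in\{0,\dots,2^{b_2}-1\}$ when $q_{y_2}\le |Z|<q_{y_2+1}$. For $u\in\mathbb{C}$ put $W_{y_1,y_2}(u)=\Pr(Y_1=y_1,Y_2=y_2\mid U=u)$, and for a Borel probability measure $F$ on $\mathbb{C}$ put $p(y_1,y_2;F)=\int_{\mathbb{C}} W_{y_1,y_2}\,dF$ and $$I(F)=-\int_{\mathbb{C}}\sum_{y_1,y_2}W_{y_1,y_2}(u)\log_2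 p(y_1,y_2;F)\,dF(u)+\int_{\mathbb{C}}\sum_{y_1,y_2}W_{y_1,y_2}(u)\log_2 W_{y_1,y_2}(u)\,dF(u),$$ the mutual information between $U\sim F$ and $(Y_1,Y_2)$. Let $\Omega$ be the set of Borel probability measures $F$ on $\mathbb{C}$ with $\int_{\mathbb{C}}|u|^2\,dF(u)\le P'$, and let $C=\sup_{F\in\Omega}I(F)$ be the capacity. Then every capacity-achieving input distribution, i.e. every $F_U^*\in\Omega$ with $I(F_U^*)=C$, has bounded support. -/

import Mathlib

open MeasureTheory
open scoped ENNReal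

noncomputable section

namespace PolarQuantization

/-- Law of `Z = u + N`, where `N` is circularly symmetric complex Gaussian noise with
`E|N|² = σ²`: its density with respect to area is `(πσ²)⁻¹ exp(-|z - u|²/σ²)`. -/
def receivedLaw (σ : ℝ) (u : ℂ) : Measure ℂ :=
  volume.withDensity fun z =>
    ENNReal.ofReal (1 / (Real.pi * σ ^ 2) * Real.exp (-(‖z - u‖ ^ 2 / σ ^ 2)))

/-- Points that the `b₁`-bit phase quantizer maps to `y₁`: the phase, taken in `[-π, π)`, lies in
`[2πy₁/2^b₁ - π, 2π(y₁+1)/2^b₁ - π)`. -/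
def phaseRegion (b₁ : ℕ) (y₁ : Fin (2 ^ b₁)) : Set ℂ :=
  {z | toIcoMod Real.two_pi_pos (-Real.pi) z.arg ∈
    Set.Ico (2 * Real.pi / 2 ^ b₁ * (y₁ : ℕ) - Real.pi)
      (2 * Real.pi / 2 ^ b₁ * ((y₁ : ℕ) + 1) - Real.pi)}

/-- `q` is a valid list of magnitude thresholds `0 = q₀ < q₁ < ⋯ < q_{2^b₂} = ∞`. -/
structure IsThresholds (b₂ : ℕ) (q : Fin (2 ^ b₂ + 1) → ℝ≥0∞) : Prop where
  zero : q 0 = 0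
  last : q (Fin.last (2 ^ b₂)) = ⊤
  strictMono : StrictMono q

/-- Points that the `b₂`-bit magnitude quantizer maps to `y₂`: `q_{y₂} ≤ |z| < q_{y₂+1}`. -/
def magnitudeRegion (b₂ : ℕ) (q : Fin (2 ^ b₂ + 1) → ℝ≥0∞) (y₂ : Fin (2 ^ b₂)) : Set ℂ :=
  {z | q y₂.castSucc ≤ ‖z‖ₑ ∧ ‖z‖ₑ < q y₂.succ}

/-- The transition probability `W_{y₁,y₂}(u) = P(Y₁ = y₁, Y₂ = y₂ | U = u)`. -/
def W (σ : ℝ) (b₁ b₂ : ℕ) (q : Fin (2 ^ b₂ + 1) → ℝ≥0∞)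
    (y₁ : Fin (2 ^ b₁)) (y₂ : Fin (2 ^ b₂)) (u : ℂ) : ℝ :=
  (receivedLaw σ u).real (phaseRegion b₁ y₁ ∩ magnitudeRegion b₂ q y₂)

/-- The output PMF `p(y₁, y₂; F)` induced by the input distribution `F`. -/
def outputPMF (σ : ℝ) (b₁ b₂ : ℕ) (q : Fin (2 ^ b₂ + 1) → ℝ≥0∞) (F : ProbabilityMeasure ℂ)
    (y₁ : Fin (2 ^ b₁)) (y₂ : Fin (2 ^ b₂)) : ℝ :=
  ∫ u, W σ b₁ b₂ q y₁ y₂ u ∂(F : Measure ℂ)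

/-- The output entropy `H(Y₁, Y₂)`, in bits. -/
def outputEntropy (σ : ℝ) (b₁ b₂ : ℕ) (q : Fin (2 ^ b₂ + 1) → ℝ≥0∞)
    (F : ProbabilityMeasure ℂ) : ℝ :=
  -∫ u, ∑ y₁, ∑ y₂, W σ b₁ b₂ q y₁ y₂ u * Real.logb 2 (outputPMF σ b₁ b₂ q F y₁ y₂)
    ∂(F : Measure ℂ)

/-- The conditional entropy `H(Y₁, Y₂ | U)`, in bits. -/
def conditionalEntropy (σ : ℝ) (b₁ b₂ : ℕ) (q : Fin (2 ^ b₂ + 1) → ℝ≥0∞)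
    (F : ProbabilityMeasure ℂ) : ℝ :=
  -∫ u, ∑ y₁, ∑ y₂, W σ b₁ b₂ q y₁ y₂ u * Real.logb 2 (W σ b₁ b₂ q y₁ y₂ u) ∂(F : Measure ℂ)

/-- The mutual information `I(F) = I(U; Y₁, Y₂)` for `U ∼ F`. -/
def mutualInformation (σ : ℝ) (b₁ b₂ : ℕ) (q : Fin (2 ^ b₂ + 1) → ℝ≥0∞)
    (F : ProbabilityMeasure ℂ) : ℝ :=
  outputEntropy σ b₁ b₂ q F - conditionalEntropy σ b₁ b₂ q F

/-- The set `Ω` of input distributions with average power `E|U|² ≤ P'`. -/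
def admissibleInputs (P' : ℝ) : Set (ProbabilityMeasure ℂ) :=
  {F | ∫⁻ u, ‖u‖ₑ ^ 2 ∂(F : Measure ℂ) ≤ ENNReal.ofReal P'}

/-- The capacity `C = sup_{F ∈ Ω} I(F)`, as a supremum in the extended reals. -/
def capacity (σ : ℝ) (b₁ b₂ : ℕ) (q : Fin (2 ^ b₂ + 1) → ℝ≥0∞) (P' : ℝ) : EReal :=
  ⨆ F ∈ admissibleInputs P', (mutualInformation σ b₁ b₂ q F : EReal)

/-- `F` is capacity-achieving: it is admissible and `I(F) = C`. -/
def IsCapacityAchieving (σ : ℝ) (b₁ b₂ : ℕ) (q : Fin (2 ^ b₂ + 1) → ℝ≥0∞) (P' : ℝ)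
    (F : ProbabilityMeasure ℂ) : Prop :=
  F ∈ admissibleInputs P' ∧ (mutualInformation σ b₁ b₂ q F : EReal) = capacity σ b₁ b₂ q P'

end PolarQuantization

end

/-!
If `P' = 0`, then `F` is the point mass at `0`. Otherwise, write `D(u)` for the relative entropy of
the output law given the input `u` with respect to the output law under the optimal input `F`. The
Karush–Kuhn–Tucker conditions provide a multiplier `m ≥ 0` with `D(u) ≤ I(F) + m (|u|² - P')` for
all `u` and equality `F`-almost everywhere. It remains to see that the inequality is strict for
large `u`. On a finite alphabet `D` is bounded, which settles the case `m > 0`. If `m = 0`, let `r`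
be the output law under `F`. A bounded cell of the quantizer becomes unlikely as `u → ∞`. An
unbounded cell `i` can be hit with probability arbitrarily close to `1`, so that `D ≤ I(F)` yields
`-log r i ≤ I(F)`, while its probability is always less than `1`, so that its log-likelihood ratio
stays below `I(F)`. Hence `D(u) < I(F)` for large `u`.
-/

noncomputable section

namespace PolarQuantization

open Filter Topology Bornology Set

section RelativeEntropy

variable {ι : Type*} [Fintype ι]

/-- The relative entropy `D(p ‖ r)`, in nats, of two laws on a finite alphabet. A letter with
`r i = 0` contributes `0` (the value given by division by zero) instead of `∞`. -/
def relEntropy (p r : ι → ℝ) : ℝ := ∑ i, p i * Real.log (p i / r i)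

theorem mul_log_div_eq_neg_mul_negMulLog (x y : ℝ) :
    x * Real.log (x / y) = -(y * Real.negMulLog (x / y)) := by
  rcases eq_or_ne y 0 with rfl | hy
  · simp
  · rw [Real.negMulLog]
    field_simp

theorem continuous_relEntropy_left (r : ι → ℝ) : Continuous fun p => relEntropy p r := by
  simp only [relEntropy, mul_log_div_eq_neg_mul_negMulLog]
  fun_prop

theorem continuousAt_relEntropy_right (p : ι → ℝ) {r : ι → ℝ} (hr : ∀ i, r i ≠ 0) :
    ContinuousAt (relEntropy p) r := by
  unfold relEntropy
  simp only [mul_log_div_eq_neg_mul_negMulLog]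
  have hdiv (i : ι) : ContinuousAt (fun r : ι → ℝ => p i / r i) r :=
    continuousAt_const.div (continuousAt_apply i r) (hr i)
  exact tendsto_finsetSum _ fun i _ => ((continuousAt_apply i r).mul
    (Real.continuous_negMulLog.continuousAt.comp (hdiv i))).neg

theorem exists_abs_relEntropy_le (r : ι → ℝ) :
    ∃ B, ∀ p ∈ stdSimplex ℝ ι, |relEntropy p r| ≤ B :=
  (isCompact_stdSimplex ℝ ι).exists_bound_of_continuousOn
    (continuous_relEntropy_left r).continuousOn

theorem relEntropy_single [DecidableEq ι] (i : ι) (r : ι → ℝ) :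
    relEntropy (Pi.single i 1) r = -Real.log (r i) := by
  rw [relEntropy, Finset.sum_eq_single i (fun j _ hj => by simp [hj]) (by simp)]
  simp

theorem relEntropy_eq_add {p q r : ι → ℝ} (hq : ∀ i, q i ≠ 0) (hr : ∀ i, r i ≠ 0) :
    relEntropy p r = relEntropy p q + ∑ i, p i * Real.log (q i / r i) := by
  simp only [relEntropy, ← Finset.sum_add_distrib, ← mul_add]
  refine Finset.sum_congr rfl fun i _ => ?_
  rcases eq_or_ne (p i) 0 with hp | hp
  · simp [hp]
  · rw [← Real.log_mul (div_ne_zero hp (hq i)) (div_ne_zero (hq i) (hr i)),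
      div_mul_div_cancel₀ (hq i)]

theorem relEntropy_nonneg {p r : ι → ℝ} (hp : ∀ i, 0 ≤ p i) (hr : ∀ i, 0 < r i)
    (hsum : ∑ i, r i ≤ ∑ i, p i) : 0 ≤ relEntropy p r := by
  have hterm (i : ι) : p i - r i ≤ p i * Real.log (p i / r i) := by
    have h := mul_nonneg (hr i).le
      (InformationTheory.klFun_nonneg (div_nonneg (hp i) (hr i).le))
    have hkl : r i * InformationTheory.klFun (p i / r i) =
        p i * Real.log (p i / r i) + r i - p i := by
      rw [InformationTheory.klFun]
      field_simp [(hr i).ne']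
    linarith
  calc 0 ≤ ∑ i, (p i - r i) := by rw [Finset.sum_sub_distrib]; linarith
    _ ≤ relEntropy p r := Finset.sum_le_sum fun i _ => hterm i

theorem relEntropy_lt_of_forall_lt_mul_exp {p r : ι → ℝ} (hp : p ∈ stdSimplex ℝ ι)
    (hr : ∀ i, 0 < r i) {c : ℝ} (h : ∀ i, p i < r i * Real.exp c) : relEntropy p r < c := by
  have hlog {i : ι} (hi : 0 < p i) : Real.log (p i / r i) < c := by
    rw [Real.log_lt_iff_lt_exp (div_pos hi (hr i)), div_lt_iff₀' (hr i)]
    exact h i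
  have hle (i : ι) : p i * Real.log (p i / r i) ≤ p i * c := by
    rcases (hp.1 i).eq_or_lt with hi | hi
    · simp [← hi]
    · exact mul_le_mul_of_nonneg_left (hlog hi).le hi.le
  obtain ⟨j, -, hj⟩ : ∃ j ∈ Finset.univ, 0 < p j :=
    Finset.exists_lt_of_sum_lt (by simp [hp.2])
  calc relEntropy p r < ∑ i, p i * c := Finset.sum_lt_sum (fun i _ => hle i)
        ⟨j, Finset.mem_univ j, mul_lt_mul_of_pos_left (hlog hj) hj⟩
    _ = c := by rw [← Finset.sum_mul, hp.2, one_mul]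

theorem tendsto_pi_single_of_tendsto_one [DecidableEq ι] {α : Type*} {l : Filter α}
    {p : α → ι → ℝ} (hp : ∀ a, p a ∈ stdSimplex ℝ ι) {i : ι}
    (hi : Tendsto (fun a => p a i) l (𝓝 1)) : Tendsto p l (𝓝 (Pi.single i 1)) := by
  refine tendsto_pi_nhds.2 fun j => ?_
  rcases eq_or_ne j i with rfl | hj
  · simpa using hi
  · rw [Pi.single_eq_of_ne hj]
    have hlim : Tendsto (fun a => 1 - p a i) l (𝓝 0) := by simpa using hi.const_sub 1
    refine squeeze_zero (fun a => (hp a).1 j) (fun a => ?_) hlim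
    rw [le_sub_iff_add_le, ← (hp a).2, ← Finset.sum_pair hj]
    exact Finset.sum_le_sum_of_subset_of_nonneg (Finset.subset_univ _) fun k _ _ => (hp a).1 k

end RelativeEntropy

section Mixture

variable {X : Type*} [MeasurableSpace X] {F G : Measure X} {t : ℝ}

/-- The mixture `(1 - t) F + t G` of two laws, meant for `t ∈ [0, 1]`. -/
def mixture (F G : Measure X) (t : ℝ) : Measure X :=
  ENNReal.ofReal (1 - t) • F + ENNReal.ofReal t • G

theorem isProbabilityMeasure_mixture [IsProbabilityMeasure F] [IsProbabilityMeasure G]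
    (ht : t ∈ Icc 0 1) : IsProbabilityMeasure (mixture F G t) := by
  constructor
  simp only [mixture, Measure.add_apply, Measure.smul_apply, measure_univ, smul_eq_mul, mul_one]
  rw [← ENNReal.ofReal_add (sub_nonneg.2 ht.2) ht.1]
  simp

theorem integrable_mixture {f : X → ℝ} (hF : Integrable f F) (hG : Integrable f G) (t : ℝ) :
    Integrable f (mixture F G t) :=
  (hF.smul_measure ENNReal.ofReal_ne_top).add_measure (hG.smul_measure ENNReal.ofReal_ne_top)

theorem integral_mixture (ht : t ∈ Icc 0 1) {f : X → ℝ} (hF : Integrable f F)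
    (hG : Integrable f G) :
    ∫ u, f u ∂(mixture F G t) = (1 - t) * ∫ u, f u ∂F + t * ∫ u, f u ∂G := by
  rw [mixture, integral_add_measure (hF.smul_measure ENNReal.ofReal_ne_top)
    (hG.smul_measure ENNReal.ofReal_ne_top), integral_smul_measure, integral_smul_measure,
    ENNReal.toReal_ofReal (sub_nonneg.2 ht.2), ENNReal.toReal_ofReal ht.1]
  rfl

/-- The input laws with mean cost at most `P`, for the cost function `s`. -/
def costConstrainedInputs (s : X → ℝ) (P : ℝ) : Set (Measure X) :=
  {F | IsProbabilityMeasure F ∧ Integrable s F ∧ ∫ u, s u ∂F ≤ P}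

variable {s : X → ℝ} {P : ℝ}

theorem mixture_mem_costConstrainedInputs (hF : F ∈ costConstrainedInputs s P)
    (hG : G ∈ costConstrainedInputs s P) (ht : t ∈ Icc 0 1) :
    mixture F G t ∈ costConstrainedInputs s P := by
  obtain ⟨_, hFs, hFP⟩ := hF
  obtain ⟨_, hGs, hGP⟩ := hG
  refine ⟨isProbabilityMeasure_mixture ht, integrable_mixture hFs hGs t, ?_⟩
  rw [integral_mixture ht hFs hGs]
  calc (1 - t) * ∫ u, s u ∂F + t * ∫ u, s u ∂G ≤ (1 - t) * P + t * P :=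
        add_le_add (mul_le_mul_of_nonneg_left hFP (sub_nonneg.2 ht.2))
          (mul_le_mul_of_nonneg_left hGP ht.1)
    _ = P := by ring

theorem dirac_mem_costConstrainedInputs (hs : Measurable s) {a : X} (ha : s a ≤ P) :
    Measure.dirac a ∈ costConstrainedInputs s P :=
  ⟨inferInstance, integrable_dirac' hs.stronglyMeasurable enorm_lt_top, by
    rwa [integral_dirac' s a hs.stronglyMeasurable]⟩

end Mixture

section Channel

variable {ι X : Type*} [Fintype ι] [MeasurableSpace X]

/-- A channel with finite output alphabet `ι`, given by its transition probabilities `w u i` from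
the input `u` to the output `i`, all of which are positive. -/
structure IsPositiveChannel (w : X → ι → ℝ) : Prop where
  measurable : Measurable w
  pos : ∀ u i, 0 < w u i
  sum_eq_one : ∀ u, ∑ i, w u i = 1

/-- The output law of the channel `w` under the input law `F`. -/
def outputProb (w : X → ι → ℝ) (F : Measure X) (i : ι) : ℝ := ∫ u, w u i ∂F

/-- The mutual information of input and output, in nats, encoded as the mean relative entropy of
the conditional output law with respect to the output law. -/
def mutualInfoNats (w : X → ι → ℝ) (F : Measure X) : ℝ :=
  ∫ u, relEntropy (w u) (outputProb w F) ∂F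

namespace IsPositiveChannel

variable {w : X → ι → ℝ} {F G : Measure X}

theorem mem_stdSimplex (hw : IsPositiveChannel w) (u : X) : w u ∈ stdSimplex ℝ ι :=
  ⟨fun i => (hw.pos u i).le, hw.sum_eq_one u⟩

theorem lt_one [Nontrivial ι] (hw : IsPositiveChannel w) (u : X) (i : ι) : w u i < 1 := by
  obtain ⟨j, hj⟩ := exists_ne i
  rw [← hw.sum_eq_one u]
  exact Finset.single_lt_sum hj (Finset.mem_univ i) (Finset.mem_univ j) (hw.pos u j)
    fun k _ _ => (hw.pos u k).le

theorem integrable (hw : IsPositiveChannel w) (F : Measure X) [IsFiniteMeasure F] (i : ι) :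
    Integrable (fun u => w u i) F :=
  Integrable.of_bound (measurable_pi_iff.1 hw.measurable i).aestronglyMeasurable 1
    (ae_of_all _ fun u => by
      rw [Real.norm_of_nonneg (hw.pos u i).le]
      exact (mem_Icc_of_mem_stdSimplex (hw.mem_stdSimplex u) i).2)

theorem measurable_relEntropy (hw : IsPositiveChannel w) (r : ι → ℝ) :
    Measurable fun u => relEntropy (w u) r :=
  (continuous_relEntropy_left r).measurable.comp hw.measurable

theorem integrable_relEntropy (hw : IsPositiveChannel w) (F : Measure X) [IsFiniteMeasure F]
    (r : ι → ℝ) : Integrable (fun u => relEntropy (w u) r) F := by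
  obtain ⟨B, hB⟩ := exists_abs_relEntropy_le r
  exact Integrable.of_bound (hw.measurable_relEntropy r).aestronglyMeasurable B
    (ae_of_all _ fun u => hB _ (hw.mem_stdSimplex u))

theorem outputProb_pos (hw : IsPositiveChannel w) (F : Measure X) [IsFiniteMeasure F] [NeZero F]
    (i : ι) : 0 < outputProb w F i := by
  rw [outputProb, integral_pos_iff_support_of_nonneg (fun u => (hw.pos u i).le) (hw.integrable F i)]
  have hsupp : Function.support (fun u => w u i) = univ :=
    eq_univ_of_forall fun u => (hw.pos u i).ne'
  rw [hsupp]
  exact Measure.measure_univ_pos.2 (NeZero.ne F)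

theorem sum_outputProb (hw : IsPositiveChannel w) (F : Measure X) [IsProbabilityMeasure F] :
    ∑ i, outputProb w F i = 1 := by
  simp only [outputProb]
  rw [← integral_finsetSum _ fun i _ => hw.integrable F i]
  simp [hw.sum_eq_one]

theorem outputProb_mixture (hw : IsPositiveChannel w) [IsFiniteMeasure F] [IsFiniteMeasure G]
    {t : ℝ} (ht : t ∈ Icc 0 1) :
    outputProb w (mixture F G t) = fun i => (1 - t) * outputProb w F i + t * outputProb w G i :=
  funext fun i => integral_mixture ht (hw.integrable F i) (hw.integrable G i)

theorem integral_relEntropy (hw : IsPositiveChannel w) (F : Measure X) [IsFiniteMeasure F]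
    [NeZero F] {r : ι → ℝ} (hr : ∀ i, r i ≠ 0) :
    ∫ u, relEntropy (w u) r ∂F = mutualInfoNats w F + relEntropy (outputProb w F) r := by
  have hint (i : ι) : Integrable (fun u => w u i * Real.log (outputProb w F i / r i)) F :=
    (hw.integrable F i).mul_const _
  have hsplit (u : X) := relEntropy_eq_add (p := w u) (fun i => (hw.outputProb_pos F i).ne') hr
  simp only [hsplit]
  rw [integral_add (hw.integrable_relEntropy F _) (integrable_finsetSum _ fun i _ => hint i),
    integral_finsetSum _ fun i _ => hint i]
  simp only [integral_mul_const, mutualInfoNats, relEntropy, outputProb]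

theorem mutualInfoNats_eq_sub (hw : IsPositiveChannel w) (F : Measure X) [IsFiniteMeasure F]
    [NeZero F] :
    mutualInfoNats w F = ∫ u, ∑ i, w u i * Real.log (w u i) ∂F -
      ∫ u, ∑ i, w u i * Real.log (outputProb w F i) ∂F := by
  have hself : Integrable (fun u => ∑ i, w u i * Real.log (w u i)) F := by
    simpa [relEntropy] using hw.integrable_relEntropy F 1
  rw [← integral_sub hself (integrable_finsetSum _ fun i _ => (hw.integrable F i).mul_const _)]
  refine integral_congr_ae (ae_of_all _ fun u => ?_)
  simp only [relEntropy, ← Finset.sum_sub_distrib, ← mul_sub]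
  exact Finset.sum_congr rfl fun i _ => by
    rw [Real.log_div (hw.pos u i).ne' (hw.outputProb_pos F i).ne']

theorem le_mutualInfoNats_mixture (hw : IsPositiveChannel w) [IsProbabilityMeasure F]
    [IsProbabilityMeasure G] {t : ℝ} (ht : t ∈ Icc 0 1) :
    (1 - t) * mutualInfoNats w F + t * ∫ u, relEntropy (w u) (outputProb w (mixture F G t)) ∂G ≤
      mutualInfoNats w (mixture F G t) := by
  have := isProbabilityMeasure_mixture (F := F) (G := G) ht
  set r := outputProb w (mixture F G t)
  have hr (i : ι) : 0 < r i := hw.outputProb_pos _ i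
  have hgibbs : 0 ≤ relEntropy (outputProb w F) r :=
    relEntropy_nonneg (fun i => (hw.outputProb_pos F i).le) hr
      (by rw [hw.sum_outputProb, hw.sum_outputProb])
  have hmix : mutualInfoNats w (mixture F G t) =
      (1 - t) * ∫ u, relEntropy (w u) r ∂F + t * ∫ u, relEntropy (w u) r ∂G :=
    integral_mixture ht (hw.integrable_relEntropy F r) (hw.integrable_relEntropy G r)
  rw [hmix, hw.integral_relEntropy F fun i => (hr i).ne']
  have := mul_nonneg (sub_nonneg.2 ht.2) hgibbs
  linarith

/-- The first-order optimality condition: the left side minus the right side is the derivative of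
the mutual information at `F` in the direction of `G`. -/
theorem integral_relEntropy_le_mutualInfoNats (hw : IsPositiveChannel w) [IsProbabilityMeasure F]
    [IsProbabilityMeasure G]
    (hmax : ∀ t ∈ Ioo (0 : ℝ) 1, mutualInfoNats w (mixture F G t) ≤ mutualInfoNats w F) :
    ∫ u, relEntropy (w u) (outputProb w F) ∂G ≤ mutualInfoNats w F := by
  have hF (i : ι) : outputProb w F i ≠ 0 := (hw.outputProb_pos F i).ne'
  have hbound : ∀ᶠ t in 𝓝[>] (0 : ℝ), mutualInfoNats w G + relEntropy (outputProb w G)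
      (fun i => (1 - t) * outputProb w F i + t * outputProb w G i) ≤ mutualInfoNats w F := by
    filter_upwards [Ioo_mem_nhdsGT (zero_lt_one (α := ℝ))] with t ht
    have htI := Ioo_subset_Icc_self ht
    have := isProbabilityMeasure_mixture (F := F) (G := G) htI
    rw [← hw.outputProb_mixture htI,
      ← hw.integral_relEntropy G fun i => (hw.outputProb_pos (mixture F G t) i).ne']
    refine le_of_mul_le_mul_left ?_ ht.1
    linarith [hw.le_mutualInfoNats_mixture (F := F) (G := G) htI, hmax t ht]
  have hpath : Tendsto (fun (t : ℝ) i => (1 - t) * outputProb w F i + t * outputProb w G i)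
      (𝓝[>] 0) (𝓝 (outputProb w F)) :=
    Tendsto.mono_left (Continuous.tendsto' (by fun_prop) _ _ (by simp)) nhdsWithin_le_nhds
  rw [hw.integral_relEntropy G hF]
  exact le_of_tendsto
    (((continuousAt_relEntropy_right (outputProb w G) hF).tendsto.comp hpath).const_add _) hbound

end IsPositiveChannel

end Channel

section ConstrainedMaximizer

/-- If every slope `(E b - c) / (s b - P)` beyond `P` is at most every slope
`(c - E a) / (P - s a)` before `P`, then a number separating the two families is a Lagrange
multiplier. -/
theorem exists_multiplier {X : Type*} {E s : X → ℝ} {P c : ℝ} {x₀ : X} (hx₀ : s x₀ < P)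
    (hle : ∀ a, s a ≤ P → E a ≤ c)
    (hcross : ∀ a b, s a < P → P < s b → (P - s a) * (E b - c) ≤ (s b - P) * (c - E a)) :
    ∃ m : ℝ, 0 ≤ m ∧ ∀ x, E x ≤ c + m * (s x - P) := by
  obtain ⟨m, hm_upper, hm_lower⟩ := exists_between_of_forall_le
    (s := insert 0 ((fun b => (E b - c) / (s b - P)) '' {b | P < s b}))
    (t := (fun a => (c - E a) / (P - s a)) '' {a | s a < P})
    (insert_nonempty _ _) (Set.Nonempty.image _ ⟨x₀, hx₀⟩) (by
      rintro _ (rfl | ⟨b, hb : P < s b, rfl⟩) _ ⟨a, ha : s a < P, rfl⟩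
      · exact div_nonneg (sub_nonneg.2 (hle a ha.le)) (sub_pos.2 ha).le
      · rw [div_le_div_iff₀ (sub_pos.2 hb) (sub_pos.2 ha)]
        linarith [hcross a b ha hb])
  refine ⟨m, hm_upper (mem_insert _ _), fun x => ?_⟩
  rcases lt_trichotomy (s x) P with hx | hx | hx
  · have hslope := hm_lower (mem_image_of_mem _ hx)
    rw [le_div_iff₀ (sub_pos.2 hx)] at hslope
    linarith
  · rw [hx, sub_self, mul_zero, add_zero]
    exact hle x hx.le
  · have hslope := hm_upper (mem_insert_of_mem _ (mem_image_of_mem _ hx))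
    rw [div_le_iff₀ (sub_pos.2 hx)] at hslope
    linarith

variable {ι X : Type*} [Fintype ι] [MeasurableSpace X] {w : X → ι → ℝ} {s : X → ℝ} {P : ℝ}
  {F G : Measure X}

theorem IsPositiveChannel.integral_relEntropy_le_of_isMaxOn (hw : IsPositiveChannel w)
    (hF : F ∈ costConstrainedInputs s P)
    (hmax : IsMaxOn (mutualInfoNats w) (costConstrainedInputs s P) F)
    (hG : G ∈ costConstrainedInputs s P) :
    ∫ u, relEntropy (w u) (outputProb w F) ∂G ≤ mutualInfoNats w F := by
  have := hF.1
  have := hG.1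
  exact hw.integral_relEntropy_le_mutualInfoNats fun t ht =>
    hmax (mixture_mem_costConstrainedInputs hF hG (Ioo_subset_Icc_self ht))

theorem IsPositiveChannel.relEntropy_le_of_isMaxOn (hw : IsPositiveChannel w) (hs : Measurable s)
    (hF : F ∈ costConstrainedInputs s P)
    (hmax : IsMaxOn (mutualInfoNats w) (costConstrainedInputs s P) F) {a : X} (ha : s a ≤ P) :
    relEntropy (w a) (outputProb w F) ≤ mutualInfoNats w F := by
  rw [← integral_dirac' (fun u => relEntropy (w u) (outputProb w F)) a
    (hw.measurable_relEntropy _).stronglyMeasurable]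
  exact hw.integral_relEntropy_le_of_isMaxOn hF hmax (dirac_mem_costConstrainedInputs hs ha)

/-- Tested on the law on `{a, b}` whose mean cost is exactly `P`. -/
theorem IsPositiveChannel.cross_le_of_isMaxOn (hw : IsPositiveChannel w) (hs : Measurable s)
    (hF : F ∈ costConstrainedInputs s P)
    (hmax : IsMaxOn (mutualInfoNats w) (costConstrainedInputs s P) F) {a b : X} (ha : s a < P)
    (hb : P < s b) :
    (P - s a) * (relEntropy (w b) (outputProb w F) - mutualInfoNats w F) ≤
      (s b - P) * (mutualInfoNats w F - relEntropy (w a) (outputProb w F)) := by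
  have hd : 0 < s b - s a := by linarith
  set t := (P - s a) / (s b - s a)
  have htd : t * (s b - s a) = P - s a := div_mul_cancel₀ _ hd.ne'
  have htI : t ∈ Icc (0 : ℝ) 1 :=
    ⟨div_nonneg (sub_pos.2 ha).le hd.le, (div_le_one hd).2 (by linarith)⟩
  have hintegral {f : X → ℝ} (hf : Measurable f) :
      ∫ u, f u ∂(mixture (Measure.dirac a) (Measure.dirac b) t) = (1 - t) * f a + t * f b := by
    have hfm := hf.stronglyMeasurable
    rw [integral_mixture htI (integrable_dirac' hfm enorm_lt_top)
      (integrable_dirac' hfm enorm_lt_top), integral_dirac' f a hfm, integral_dirac' f b hfm]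
  have hmem : mixture (Measure.dirac a) (Measure.dirac b) t ∈ costConstrainedInputs s P :=
    ⟨isProbabilityMeasure_mixture htI,
      integrable_mixture (integrable_dirac' hs.stronglyMeasurable enorm_lt_top)
        (integrable_dirac' hs.stronglyMeasurable enorm_lt_top) t,
      by rw [hintegral hs]; linarith⟩
  have hmean := hw.integral_relEntropy_le_of_isMaxOn hF hmax hmem
  rw [hintegral (hw.measurable_relEntropy _)] at hmean
  have hscaled := mul_le_mul_of_nonneg_left hmean hd.le
  linear_combination hscaled - (relEntropy (w b) (outputProb w F) -
    relEntropy (w a) (outputProb w F)) * htd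

theorem IsPositiveChannel.exists_multiplier_of_isMaxOn (hw : IsPositiveChannel w)
    (hs : Measurable s) {x₀ : X} (hx₀ : s x₀ < P) (hF : F ∈ costConstrainedInputs s P)
    (hmax : IsMaxOn (mutualInfoNats w) (costConstrainedInputs s P) F) :
    ∃ m : ℝ, 0 ≤ m ∧
      (∀ u, relEntropy (w u) (outputProb w F) ≤ mutualInfoNats w F + m * (s u - P)) ∧
      ∀ᵐ u ∂F, relEntropy (w u) (outputProb w F) = mutualInfoNats w F + m * (s u - P) := by
  obtain ⟨m, hm, hle⟩ := exists_multiplier hx₀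
    (fun _ ha => hw.relEntropy_le_of_isMaxOn hs hF hmax ha)
    (fun _ _ ha hb => hw.cross_le_of_isMaxOn hs hF hmax ha hb)
  refine ⟨m, hm, hle, ?_⟩
  obtain ⟨_, hFs, hFP⟩ := hF
  have hslack : Integrable (fun u => m * (s u - P)) F :=
    (hFs.sub (integrable_const P)).const_mul m
  have hbound := (integrable_const (μ := F) (mutualInfoNats w F)).add hslack
  have hrel := hw.integrable_relEntropy F (outputProb w F)
  refine (integral_eq_iff_of_ae_le hrel hbound (ae_of_all _ hle)).1
    (le_antisymm (integral_mono hrel hbound hle) ?_)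
  simp only [Pi.add_apply]
  rw [integral_add (integrable_const _) hslack, integral_const_mul,
    integral_sub hFs (integrable_const _)]
  simp only [integral_const, probReal_univ, one_smul]
  exact add_le_of_nonpos_right (mul_nonpos_of_nonneg_of_nonpos hm (sub_nonpos.2 hFP))

theorem IsPositiveChannel.one_le_outputProb_mul_exp (hw : IsPositiveChannel w)
    [IsFiniteMeasure F] [NeZero F] {c : ℝ} (hle : ∀ u, relEntropy (w u) (outputProb w F) ≤ c)
    {i : ι} (hi : (1 : ℝ) ∈ closure (range fun u => w u i)) :
    1 ≤ outputProb w F i * Real.exp c := by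
  classical
  obtain ⟨x, hx_mem, hx⟩ := mem_closure_iff_seq_limit.1 hi
  choose v hv using hx_mem
  have hvertex : Tendsto (fun n => w (v n)) atTop (𝓝 (Pi.single i 1)) :=
    tendsto_pi_single_of_tendsto_one (fun n => hw.mem_stdSimplex (v n)) (by simpa only [hv])
  have hlog : -Real.log (outputProb w F i) ≤ c := by
    rw [← relEntropy_single]
    exact le_of_tendsto (((continuous_relEntropy_left _).tendsto _).comp hvertex)
      (Eventually.of_forall fun n => hle (v n))
  rw [neg_le, Real.le_log_iff_exp_le (hw.outputProb_pos F i), Real.exp_neg] at hlog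
  rwa [← inv_le_iff_one_le_mul₀ (Real.exp_pos c)]

variable {l : Filter X}

/-- An output letter that does not become unlikely is still less likely than the supremum `1`, and
the bound on the relative entropy near that supremum makes the letter likely under `F`. -/
theorem IsPositiveChannel.eventually_relEntropy_lt [Nontrivial ι] (hw : IsPositiveChannel w)
    [IsFiniteMeasure F] [NeZero F]
    (hlim : ∀ i, Tendsto (fun u => w u i) l (𝓝 0) ∨ (1 : ℝ) ∈ closure (range fun u => w u i))
    {c : ℝ} (hle : ∀ u, relEntropy (w u) (outputProb w F) ≤ c) :
    ∀ᶠ u in l, relEntropy (w u) (outputProb w F) < c := by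
  have hletter (i : ι) : ∀ᶠ u in l, w u i < outputProb w F i * Real.exp c := by
    rcases hlim i with hi | hi
    · exact hi.eventually_lt_const (mul_pos (hw.outputProb_pos F i) (Real.exp_pos c))
    · exact Eventually.of_forall fun u =>
        (hw.lt_one u i).trans_le (hw.one_le_outputProb_mul_exp hle hi)
  filter_upwards [eventually_all.2 hletter] with u hu
  exact relEntropy_lt_of_forall_lt_mul_exp (hw.mem_stdSimplex u) (hw.outputProb_pos F) hu

theorem IsPositiveChannel.eventually_relEntropy_lt_add_mul (hw : IsPositiveChannel w)
    (hsl : Tendsto s l atTop) {m : ℝ} (hm : 0 < m) (r : ι → ℝ) (c P : ℝ) :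
    ∀ᶠ u in l, relEntropy (w u) r < c + m * (s u - P) := by
  obtain ⟨B, hB⟩ := exists_abs_relEntropy_le r
  have hcost : Tendsto (fun u => c + m * (s u - P)) l atTop :=
    tendsto_atTop_add_const_left _ c
      ((tendsto_atTop_add_const_right l (-P) hsl).const_mul_atTop hm)
  filter_upwards [hcost.eventually_gt_atTop B] with u hu
  exact ((le_abs_self _).trans (hB _ (hw.mem_stdSimplex u))).trans_lt hu

theorem disjoint_ae_of_forall_le_cost (hF : F ∈ costConstrainedInputs s P)
    (hP : ∀ u, P ≤ s u) (hsl : Tendsto s l atTop) : Disjoint l (ae F) := by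
  obtain ⟨_, hFs, hFP⟩ := hF
  have hcost : ∀ᵐ u ∂F, P = s u := by
    refine (integral_eq_iff_of_ae_le (integrable_const P) hFs (ae_of_all _ hP)).1
      (le_antisymm (integral_mono (integrable_const P) hFs hP) ?_)
    simpa using hFP
  exact disjoint_of_disjoint_of_mem (disjoint_left.2 fun u (hu : P < s u) hu' => hu.ne hu')
    (hsl.eventually_gt_atTop P) hcost

theorem IsPositiveChannel.disjoint_ae_of_isMaxOn [Nontrivial ι] (hw : IsPositiveChannel w)
    (hs : Measurable s) (hsl : Tendsto s l atTop)
    (hlim : ∀ i, Tendsto (fun u => w u i) l (𝓝 0) ∨ (1 : ℝ) ∈ closure (range fun u => w u i))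
    (hF : F ∈ costConstrainedInputs s P)
    (hmax : IsMaxOn (mutualInfoNats w) (costConstrainedInputs s P) F) : Disjoint l (ae F) := by
  by_cases hP : ∀ u, P ≤ s u
  · exact disjoint_ae_of_forall_le_cost hF hP hsl
  obtain ⟨x₀, hx₀⟩ := not_forall.1 hP
  obtain ⟨m, hm, hle, heq⟩ := hw.exists_multiplier_of_isMaxOn hs (not_le.1 hx₀) hF hmax
  have hlt : ∀ᶠ u in l,
      relEntropy (w u) (outputProb w F) < mutualInfoNats w F + m * (s u - P) := by
    rcases hm.eq_or_lt with rfl | hm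
    · have := hF.1
      simp only [zero_mul, add_zero] at hle ⊢
      exact hw.eventually_relEntropy_lt hlim hle
    · exact hw.eventually_relEntropy_lt_add_mul hsl hm _ _ P
  refine disjoint_of_disjoint_of_mem (disjoint_left.2 fun u => ?_) hlt heq
  exact fun (hu : _ < _) hu' => hu.ne hu'

theorem isBounded_support_of_disjoint_ae {X : Type*} [PseudoMetricSpace X] [MeasurableSpace X]
    {F : Measure X} (hF : Disjoint (cobounded X) (ae F)) : IsBounded F.support := by
  obtain ⟨A, hA, B, hB, hAB⟩ := Filter.disjoint_iff.1 hF
  have hbdd : IsBounded B := isBounded_def.2 (mem_of_superset hA hAB.subset_compl_right)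
  exact hbdd.closure.subset
    (Measure.support_subset_of_isClosed isClosed_closure (mem_of_superset hB subset_closure))

end ConstrainedMaximizer

section AdditiveNoise

variable {E ι : Type*} [SeminormedAddCommGroup E] [MeasurableSpace E]

/-- The transition probabilities from `u` to the index `i` of the cell `Q i` containing `u + N`,
where `N` is noise with law `μ`. -/
def quantizedChannel (μ : Measure E) (Q : ι → Set E) (u : E) (i : ι) : ℝ :=
  μ.real ((u + ·) ⁻¹' Q i)

/-- The sets `Q i` are the cells of a quantizer: they partition the space measurably, and each of
them contains an open set, so that noise of full support reaches it. -/
structure IsQuantizer (Q : ι → Set E) : Prop where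
  measurableSet : ∀ i, MeasurableSet (Q i)
  existsUnique_mem : ∀ z, ∃! i, z ∈ Q i
  interior_nonempty : ∀ i, (interior (Q i)).Nonempty

variable {μ : Measure E} {Q : ι → Set E}

theorem IsQuantizer.isPositiveChannel [Fintype ι] [BorelSpace E] [SecondCountableTopology E]
    (hQ : IsQuantizer Q) [IsProbabilityMeasure μ] [μ.IsOpenPosMeasure] :
    IsPositiveChannel (quantizedChannel μ Q) where
  measurable := measurable_pi_iff.2 fun i =>
    (measurable_measure_prodMk_left (measurable_add (hQ.measurableSet i))).ennreal_toReal
  pos u i := by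
    have hint : (interior ((u + ·) ⁻¹' Q i)).Nonempty :=
      ((hQ.interior_nonempty i).preimage (add_left_surjective u)).mono
        (preimage_interior_subset_interior_preimage (continuous_const_add u))
    exact ENNReal.toReal_pos (Measure.measure_pos_of_nonempty_interior μ hint).ne'
      (measure_ne_top _ _)
  sum_eq_one u := by
    have hcover : ⋃ i, (u + ·) ⁻¹' Q i = univ :=
      eq_univ_of_forall fun z => mem_iUnion.2 (hQ.existsUnique_mem (u + z)).exists
    have hdisj : Pairwise (Function.onFun Disjoint fun i => (u + ·) ⁻¹' Q i) := fun i j hij =>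
      disjoint_left.2 fun z hi hj => hij ((hQ.existsUnique_mem (u + z)).unique hi hj)
    simp only [quantizedChannel]
    rw [← measureReal_iUnion_fintype hdisj
      fun i => (continuous_const_add u).measurable (hQ.measurableSet i), hcover, probReal_univ]

theorem tendsto_measureReal_ball_atTop (μ : Measure E) [IsProbabilityMeasure μ] :
    Tendsto (fun R => μ.real (Metric.ball 0 R)) atTop (𝓝 1) := by
  have hball := tendsto_measure_iUnion_atTop (μ := μ) (s := Metric.ball (0 : E))
    fun _ _ => Metric.ball_subset_ball
  have hcover : ⋃ R, Metric.ball (0 : E) R = univ :=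
    eq_univ_of_forall fun z => mem_iUnion.2 ⟨‖z‖ + 1, by simp⟩
  rw [hcover, measure_univ] at hball
  exact (ENNReal.tendsto_toReal ENNReal.one_ne_top).comp hball

theorem tendsto_quantizedChannel_cobounded [OpensMeasurableSpace E] [IsProbabilityMeasure μ]
    {i : ι} (hi : IsBounded (Q i)) :
    Tendsto (fun u => quantizedChannel μ Q u i) (cobounded E) (𝓝 0) := by
  obtain ⟨r, hr⟩ := hi.exists_norm_le
  have hfar : Tendsto (fun u : E => 1 - μ.real (Metric.ball 0 (‖u‖ - r))) (cobounded E) (𝓝 0) := by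
    rw [← sub_self (1 : ℝ)]
    exact ((tendsto_measureReal_ball_atTop μ).comp
      (tendsto_atTop_add_const_right _ (-r) tendsto_norm_cobounded_atTop)).const_sub 1
  refine squeeze_zero (fun u => measureReal_nonneg) (fun u => ?_) hfar
  rw [← probReal_compl_eq_one_sub Metric.isOpen_ball.measurableSet]
  refine measureReal_mono fun z hz hz' => ?_
  have hsum : ‖u + z‖ ≤ r := hr _ hz
  have htri : ‖u‖ - ‖z‖ ≤ ‖u + z‖ := by simpa using norm_sub_norm_le u (-z)
  rw [mem_ball_zero_iff] at hz'
  linarith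

theorem one_mem_closure_range_quantizedChannel [IsProbabilityMeasure μ] {i : ι}
    (hi : ∀ R, ∃ u, Metric.ball u R ⊆ Q i) :
    (1 : ℝ) ∈ closure (range fun u => quantizedChannel μ Q u i) := by
  choose u hu using hi
  refine mem_closure_of_tendsto (f := fun R => quantizedChannel μ Q (u R) i)
    (tendsto_of_tendsto_of_tendsto_of_le_of_le (tendsto_measureReal_ball_atTop μ)
      tendsto_const_nhds (fun R => measureReal_mono fun z hz => hu R ?_)
      fun R => measureReal_le_one) (Eventually.of_forall fun R => mem_range_self (u R))
  simpa using hz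

theorem isBounded_support_of_isMaxOn_quantizedChannel [BorelSpace E] [SecondCountableTopology E]
    [Fintype ι] [Nontrivial ι] [IsProbabilityMeasure μ] [μ.IsOpenPosMeasure] (hQ : IsQuantizer Q)
    (hcell : ∀ i, IsBounded (Q i) ∨ ∀ R, ∃ u, Metric.ball u R ⊆ Q i) {s : E → ℝ}
    (hs : Measurable s) (hs_top : Tendsto s (cobounded E) atTop) {P : ℝ} {F : Measure E}
    (hF : F ∈ costConstrainedInputs s P)
    (hmax : IsMaxOn (mutualInfoNats (quantizedChannel μ Q)) (costConstrainedInputs s P) F) :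
    IsBounded F.support :=
  isBounded_support_of_disjoint_ae <| hQ.isPositiveChannel.disjoint_ae_of_isMaxOn hs hs_top
    (fun i => (hcell i).imp tendsto_quantizedChannel_cobounded
      one_mem_closure_range_quantizedChannel) hF hmax

end AdditiveNoise

section PolarQuantizer

theorem toIcoMod_arg (z : ℂ) : toIcoMod Real.two_pi_pos (-Real.pi) z.arg =
    if z.arg = Real.pi then -Real.pi else z.arg := by
  split_ifs with h
  · rw [h, toIcoMod_eq_iff]
    exact ⟨⟨le_rfl, by linarith [Real.pi_pos]⟩, 1, by simp; ring⟩
  · rw [toIcoMod_eq_self]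
    exact ⟨(Complex.neg_pi_lt_arg z).le, by linarith [(Complex.arg_le_pi z).lt_of_ne h]⟩

theorem measurableSet_phaseRegion (b : ℕ) (y : Fin (2 ^ b)) :
    MeasurableSet (phaseRegion b y) := by
  simp only [phaseRegion, toIcoMod_arg]
  exact Measurable.ite (Complex.measurable_arg (measurableSet_singleton _)) measurable_const
    Complex.measurable_arg measurableSet_Ico

theorem measurableSet_magnitudeRegion (b : ℕ) (q : Fin (2 ^ b + 1) → ℝ≥0∞) (y : Fin (2 ^ b)) :
    MeasurableSet (magnitudeRegion b q y) :=
  (measurableSet_le measurable_const measurable_enorm).inter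
    (measurableSet_lt measurable_enorm measurable_const)

theorem existsUnique_fin_mem_Ico_mul {d : ℝ} (hd : 0 < d) {n : ℕ} {x : ℝ}
    (hx : x ∈ Ico 0 (d * n)) : ∃! k : Fin n, x ∈ Ico (d * k) (d * (k + 1)) := by
  have hquot : 0 ≤ x / d := div_nonneg hx.1 hd.le
  have hmem (k : ℕ) : x ∈ Ico (d * k) (d * (k + 1)) ↔ ⌊x / d⌋₊ = k := by
    rw [Nat.floor_eq_iff hquot, le_div_iff₀' hd, div_lt_iff₀' hd, mem_Ico]
  have hfloor : ⌊x / d⌋₊ < n := by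
    rw [Nat.floor_lt hquot, div_lt_iff₀' hd]
    exact hx.2
  simp only [hmem]
  exact ⟨⟨⌊x / d⌋₊, hfloor⟩, rfl, fun k hk => Fin.ext hk.symm⟩

theorem existsUnique_mem_phaseRegion (b : ℕ) (z : ℂ) : ∃! y, z ∈ phaseRegion b y := by
  have hd : 0 < 2 * Real.pi / 2 ^ b := by positivity
  have hphase := toIcoMod_mem_Ico Real.two_pi_pos (-Real.pi) z.arg
  have hshift : toIcoMod Real.two_pi_pos (-Real.pi) z.arg + Real.pi ∈
      Ico 0 (2 * Real.pi / 2 ^ b * (2 ^ b : ℕ)) := by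
    rw [Nat.cast_pow, Nat.cast_ofNat, div_mul_cancel₀ _ (by positivity)]
    exact ⟨by linarith [hphase.1], by linarith [hphase.2]⟩
  simpa only [phaseRegion, mem_Ico, mem_ofPred_eq, sub_le_iff_le_add, lt_sub_iff_add_lt]
    using existsUnique_fin_mem_Ico_mul hd hshift

theorem existsUnique_castSucc_le_lt_succ {α : Type*} [LinearOrder α] {n : ℕ}
    {q : Fin (n + 1) → α} (hq : Monotone q) {x : α} (h0 : q 0 ≤ x) (hlast : x < q (Fin.last n)) :
    ∃! i : Fin n, q i.castSucc ≤ x ∧ x < q i.succ := by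
  refine existsUnique_of_exists_of_unique ?_ fun i j hi hj => ?_
  · by_contra! hstep
    exact hlast.not_ge (Fin.induction h0 hstep (Fin.last n))
  · exact le_antisymm (Fin.castSucc_lt_succ_iff.1 (hq.reflect_lt (hi.1.trans_lt hj.2)))
      (Fin.castSucc_lt_succ_iff.1 (hq.reflect_lt (hj.1.trans_lt hi.2)))

/-- The open sector of nonzero complex numbers with phase in `(a, b)`, the negative real axis being
removed since the phase jumps there. -/
def openSector (a b : ℝ) : Set ℂ := Complex.slitPlane ∩ Complex.arg ⁻¹' Ioo a b

variable {a b : ℝ}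

theorem isOpen_openSector (a b : ℝ) : IsOpen (openSector a b) :=
  ContinuousOn.isOpen_inter_preimage
    (fun _ hz => (Complex.continuousAt_arg hz).continuousWithinAt) Complex.isOpen_slitPlane
    isOpen_Ioo

theorem mul_mem_openSector {z : ℂ} (hz : z ∈ openSector a b) {t : ℝ} (ht : 0 < t) :
    (t : ℂ) * z ∈ openSector a b := by
  obtain ⟨hslit, harg⟩ := hz
  rw [Complex.mem_slitPlane_iff_arg] at hslit
  refine ⟨?_, by rwa [mem_preimage, Complex.arg_real_mul z ht]⟩
  rw [Complex.mem_slitPlane_iff_arg, Complex.arg_real_mul z ht]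
  exact ⟨hslit.1, mul_ne_zero (Complex.ofReal_ne_zero.2 ht.ne') hslit.2⟩

theorem exists_norm_eq_one_mem_openSector (ha : -Real.pi ≤ a) (hab : a < b)
    (hb : b ≤ Real.pi) : ∃ z ∈ openSector a b, ‖z‖ = 1 := by
  obtain ⟨θ, haθ, hθb⟩ := exists_between hab
  have hθ : θ ∈ Ioo (-Real.pi) Real.pi := ⟨ha.trans_lt haθ, hθb.trans_le hb⟩
  have harg : (Complex.exp (θ * Complex.I)).arg = θ := by
    rw [Complex.arg_exp_mul_I, toIocMod_eq_self]
    exact ⟨hθ.1, by linarith [hθ.2]⟩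
  refine ⟨Complex.exp (θ * Complex.I), ⟨?_, ?_⟩, Complex.norm_exp_ofReal_mul_I θ⟩
  · rw [Complex.mem_slitPlane_iff_arg, harg]
    exact ⟨hθ.2.ne, Complex.exp_ne_zero _⟩
  · rw [mem_preimage, harg]
    exact ⟨haθ, hθb⟩

theorem exists_ball_subset_openSector (ha : -Real.pi ≤ a) (hab : a < b) (hb : b ≤ Real.pi)
    (r R : ℝ) : ∃ u, Metric.ball u R ⊆ openSector a b ∩ {z | r ≤ ‖z‖} := by
  obtain ⟨z, hz, hz_norm⟩ := exists_norm_eq_one_mem_openSector ha hab hb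
  obtain ⟨e, he, hball⟩ := Metric.isOpen_iff.1 (isOpen_openSector a b) z hz
  obtain ⟨t, htR, htr, ht⟩ : ∃ t : ℝ, R ≤ t * e ∧ r + R ≤ t ∧ 0 < t :=
    (((tendsto_id.atTop_mul_const he).eventually_ge_atTop R).and
      ((eventually_ge_atTop (r + R)).and (eventually_gt_atTop 0))).exists
  have ht_norm : ‖(t : ℂ)‖ = t := by rw [Complex.norm_real, Real.norm_of_nonneg ht.le]
  refine ⟨t * z, fun x hx => ⟨?_, ?_⟩⟩
  · have hx_eq : x = t * (x / t) := (mul_div_cancel₀ x (Complex.ofReal_ne_zero.2 ht.ne')).symm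
    rw [hx_eq] at hx ⊢
    refine mul_mem_openSector (hball ?_) ht
    rw [mem_ball_iff_norm, ← mul_sub, norm_mul, ht_norm] at hx
    exact mem_ball_iff_norm.2 (lt_of_mul_lt_mul_left (hx.trans_le htR) ht.le)
  · have htz : ‖t * z‖ = t := by rw [norm_mul, ht_norm, hz_norm, mul_one]
    have htri := norm_sub_norm_le (t * z) x
    rw [mem_ball_iff_norm'] at hx
    rw [mem_ofPred_eq]
    linarith

theorem exists_openSector_subset_phaseRegion (n : ℕ) (y : Fin (2 ^ n)) :
    ∃ a b, -Real.pi ≤ a ∧ a < b ∧ b ≤ Real.pi ∧ openSector a b ⊆ phaseRegion n y := by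
  have hd : 0 < 2 * Real.pi / 2 ^ n := by positivity
  have hupper : 2 * Real.pi / 2 ^ n * ((y : ℕ) + 1) ≤ 2 * Real.pi := by
    have hy : ((y : ℕ) : ℝ) + 1 ≤ 2 ^ n := by exact_mod_cast y.2
    calc 2 * Real.pi / 2 ^ n * ((y : ℕ) + 1) ≤ 2 * Real.pi / 2 ^ n * 2 ^ n := by gcongr
      _ = 2 * Real.pi := div_mul_cancel₀ _ (by positivity)
  refine ⟨2 * Real.pi / 2 ^ n * (y : ℕ) - Real.pi, 2 * Real.pi / 2 ^ n * ((y : ℕ) + 1) - Real.pi,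
    ?_, by linarith, by linarith, ?_⟩
  · rw [neg_le_sub_iff_le_add, le_add_iff_nonneg_left]
    positivity
  · rintro z ⟨hslit, harg⟩
    rw [phaseRegion, mem_ofPred_eq, toIcoMod_arg, if_neg (Complex.mem_slitPlane_iff_arg.1 hslit).1]
    exact Ioo_subset_Ico_self harg

/-- The inputs `z` to which the phase and magnitude quantizers together assign the label `y`. -/
def polarCell (b₁ b₂ : ℕ) (q : Fin (2 ^ b₂ + 1) → ℝ≥0∞) (y : Fin (2 ^ b₁) × Fin (2 ^ b₂)) :
    Set ℂ :=
  phaseRegion b₁ y.1 ∩ magnitudeRegion b₂ q y.2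

variable {b₁ b₂ : ℕ} {q : Fin (2 ^ b₂ + 1) → ℝ≥0∞}

theorem existsUnique_mem_polarCell (hq : IsThresholds b₂ q) (z : ℂ) :
    ∃! y, z ∈ polarCell b₁ b₂ q y := by
  obtain ⟨y₁, hy₁, hy₁_unique⟩ := existsUnique_mem_phaseRegion b₁ z
  obtain ⟨y₂, hy₂, hy₂_unique⟩ := existsUnique_castSucc_le_lt_succ hq.strictMono.monotone
    (hq.zero.trans_le zero_le) (enorm_lt_top.trans_eq hq.last.symm : ‖z‖ₑ < _)
  exact ⟨(y₁, y₂), ⟨hy₁, hy₂⟩, fun y hy =>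
    Prod.ext (hy₁_unique y.1 hy.1) (hy₂_unique y.2 hy.2)⟩

theorem interior_polarCell_nonempty (hq : StrictMono q) (y : Fin (2 ^ b₁) × Fin (2 ^ b₂)) :
    (interior (polarCell b₁ b₂ q y)).Nonempty := by
  obtain ⟨a, b, ha, hab, hb, hsector⟩ := exists_openSector_subset_phaseRegion b₁ y.1
  obtain ⟨z, hz, hz_norm⟩ := exists_norm_eq_one_mem_openSector ha hab hb
  obtain ⟨t, hqt, htq⟩ := ENNReal.lt_iff_exists_nnreal_btwn.1
    (hq (Fin.castSucc_lt_succ (i := y.2)))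
  have ht : 0 < (t : ℝ) := NNReal.coe_pos.2 (ENNReal.coe_pos.1 (bot_le.trans_lt hqt))
  have htz : ‖((t : ℝ) : ℂ) * z‖ₑ = t := by
    rw [← ofReal_norm, norm_mul, hz_norm, mul_one, Complex.norm_real, NNReal.norm_eq,
      ENNReal.ofReal_coe_nnreal]
  have hopen : IsOpen (openSector a b ∩ {z | q y.2.castSucc < ‖z‖ₑ ∧ ‖z‖ₑ < q y.2.succ}) :=
    (isOpen_openSector a b).inter ((isOpen_lt continuous_const continuous_enorm).inter
      (isOpen_lt continuous_enorm continuous_const))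
  have hsubset : openSector a b ∩ {z | q y.2.castSucc < ‖z‖ₑ ∧ ‖z‖ₑ < q y.2.succ} ⊆
      polarCell b₁ b₂ q y :=
    inter_subset_inter hsector fun _ hz => ⟨hz.1.le, hz.2⟩
  exact ⟨t * z, interior_maximal hsubset hopen
    ⟨mul_mem_openSector hz ht, by rwa [htz], by rwa [htz]⟩⟩

theorem isQuantizer_polarCell (hq : IsThresholds b₂ q) : IsQuantizer (polarCell b₁ b₂ q) where
  measurableSet y :=
    (measurableSet_phaseRegion b₁ y.1).inter (measurableSet_magnitudeRegion b₂ q y.2)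
  existsUnique_mem := existsUnique_mem_polarCell hq
  interior_nonempty := interior_polarCell_nonempty hq.strictMono

theorem isBounded_polarCell {y : Fin (2 ^ b₁) × Fin (2 ^ b₂)} (hy : q y.2.succ ≠ ⊤) :
    IsBounded (polarCell b₁ b₂ q y) :=
  isBounded_iff_forall_norm_le.2 ⟨(q y.2.succ).toReal, fun z hz => by
    rw [← toReal_enorm]
    exact ENNReal.toReal_mono hy hz.2.2.le⟩

theorem exists_ball_subset_polarCell (hq : StrictMono q) {y : Fin (2 ^ b₁) × Fin (2 ^ b₂)}
    (hy : q y.2.succ = ⊤) (R : ℝ) : ∃ u, Metric.ball u R ⊆ polarCell b₁ b₂ q y := by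
  obtain ⟨a, b, ha, hab, hb, hsector⟩ := exists_openSector_subset_phaseRegion b₁ y.1
  have hfinite : q y.2.castSucc ≠ ⊤ := (hq (Fin.castSucc_lt_succ (i := y.2))).ne_top
  obtain ⟨u, hu⟩ := exists_ball_subset_openSector ha hab hb (q y.2.castSucc).toReal R
  refine ⟨u, hu.trans (inter_subset_inter hsector fun z hz => ⟨?_, by simp [hy]⟩)⟩
  rw [← ofReal_norm]
  exact (ENNReal.le_ofReal_iff_toReal_le hfinite (norm_nonneg z)).2 hz

end PolarQuantizer

section PolarQuantizedGaussianChannel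

variable {σ : ℝ}

theorem isProbabilityMeasure_receivedLaw (hσ : σ ≠ 0) (u : ℂ) :
    IsProbabilityMeasure (receivedLaw σ u) := by
  have hmass : ∫ z : ℂ, Real.exp (-(‖z‖ ^ 2 / σ ^ 2)) = Real.pi * σ ^ 2 := by
    have hgauss := GaussianFourier.integral_rexp_neg_mul_sq_norm (V := ℂ)
      (b := (σ ^ 2)⁻¹) (by positivity)
    simpa [Complex.finrank_real_complex, div_eq_inv_mul, mul_comm] using hgauss
  have hmass_ne : Real.pi * σ ^ 2 ≠ 0 := by positivity
  constructor
  rw [receivedLaw, withDensity_apply _ MeasurableSet.univ, Measure.restrict_univ,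
    lintegral_sub_right_eq_self (fun z : ℂ => ENNReal.ofReal
      (1 / (Real.pi * σ ^ 2) * Real.exp (-(‖z‖ ^ 2 / σ ^ 2)))) u,
    ← ofReal_integral_eq_lintegral_ofReal, integral_const_mul, hmass, one_div_mul_cancel hmass_ne,
    ENNReal.ofReal_one]
  · exact (not_imp_comm.1 integral_undef (hmass.trans_ne hmass_ne)).const_mul _
  · exact ae_of_all _ fun z => by positivity

theorem isOpenPosMeasure_receivedLaw (hσ : σ ≠ 0) (u : ℂ) :
    (receivedLaw σ u).IsOpenPosMeasure := by
  refine Measure.AbsolutelyContinuous.isOpenPosMeasure (μ := volume)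
    (withDensity_absolutelyContinuous' (by fun_prop) (ae_of_all _ fun z => ?_))
  exact (ENNReal.ofReal_pos.2 (by positivity)).ne'

theorem receivedLaw_apply_eq_preimage (σ : ℝ) (u : ℂ) {A : Set ℂ} (hA : MeasurableSet A) :
    receivedLaw σ u A = receivedLaw σ 0 ((u + ·) ⁻¹' A) := by
  have htranslate := measurePreserving_add_left (volume : Measure ℂ) u
  rw [receivedLaw, receivedLaw, withDensity_apply _ hA,
    withDensity_apply _ (htranslate.measurable hA),
    ← htranslate.setLIntegral_comp_preimage hA (by fun_prop)]
  simp

theorem W_eq_quantizedChannel (σ : ℝ) (b₁ b₂ : ℕ) (q : Fin (2 ^ b₂ + 1) → ℝ≥0∞)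
    (y : Fin (2 ^ b₁) × Fin (2 ^ b₂)) (u : ℂ) :
    W σ b₁ b₂ q y.1 y.2 u = quantizedChannel (receivedLaw σ 0) (polarCell b₁ b₂ q) u y :=
  congrArg ENNReal.toReal (receivedLaw_apply_eq_preimage σ u
    ((measurableSet_phaseRegion b₁ y.1).inter (measurableSet_magnitudeRegion b₂ q y.2)))

variable {b₁ b₂ : ℕ} {q : Fin (2 ^ b₂ + 1) → ℝ≥0∞}

theorem mutualInformation_eq_mutualInfoNats_div (hσ : σ ≠ 0) (hq : IsThresholds b₂ q)
    (F : ProbabilityMeasure ℂ) :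
    mutualInformation σ b₁ b₂ q F =
      mutualInfoNats (quantizedChannel (receivedLaw σ 0) (polarCell b₁ b₂ q)) F / Real.log 2 := by
  have := isProbabilityMeasure_receivedLaw hσ 0
  have := isOpenPosMeasure_receivedLaw hσ 0
  have hlogb (f g : Fin (2 ^ b₁) → Fin (2 ^ b₂) → ℝ) :
      ∑ y₁, ∑ y₂, f y₁ y₂ * Real.logb 2 (g y₁ y₂) =
        (∑ y : Fin (2 ^ b₁) × Fin (2 ^ b₂), f y.1 y.2 * Real.log (g y.1 y.2)) / Real.log 2 := by
    simp only [Fintype.sum_prod_type, Finset.sum_div, Real.logb, mul_div_assoc]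
  rw [(isQuantizer_polarCell hq).isPositiveChannel.mutualInfoNats_eq_sub, mutualInformation,
    outputEntropy, conditionalEntropy, sub_neg_eq_add, neg_add_eq_sub]
  simp only [fun u => hlogb (W σ b₁ b₂ q · · u) (outputPMF σ b₁ b₂ q F),
    fun u => hlogb (W σ b₁ b₂ q · · u) (W σ b₁ b₂ q · · u), integral_div, ← sub_div]
  simp only [outputPMF, outputProb, W_eq_quantizedChannel]

theorem mem_admissibleInputs_iff {P : ℝ} (hP : 0 ≤ P) {F : ProbabilityMeasure ℂ} :
    F ∈ admissibleInputs P ↔ (F : Measure ℂ) ∈ costConstrainedInputs (fun u => ‖u‖ ^ 2) P := by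
  have hnonneg : 0 ≤ᵐ[(F : Measure ℂ)] fun u => ‖u‖ ^ 2 := ae_of_all _ fun u => by positivity
  have henorm : ∫⁻ u, ‖u‖ₑ ^ 2 ∂(F : Measure ℂ) =
      ∫⁻ u, ENNReal.ofReal (‖u‖ ^ 2) ∂(F : Measure ℂ) := by
    simp only [ENNReal.ofReal_pow (norm_nonneg _), ofReal_norm]
  have hpower (hint : Integrable (fun u => ‖u‖ ^ 2) (F : Measure ℂ)) :
      F ∈ admissibleInputs P ↔ ∫ u, ‖u‖ ^ 2 ∂(F : Measure ℂ) ≤ P := by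
    rw [admissibleInputs, mem_ofPred_eq, henorm, ← ofReal_integral_eq_lintegral_ofReal hint hnonneg,
      ENNReal.ofReal_le_ofReal_iff hP]
  refine ⟨fun hF => ?_, fun ⟨_, hint, hF⟩ => (hpower hint).2 hF⟩
  have hint : Integrable (fun u => ‖u‖ ^ 2) (F : Measure ℂ) := by
    rw [← lintegral_ofReal_ne_top_iff_integrable (by fun_prop) hnonneg, ← henorm]
    exact ne_top_of_le_ne_top ENNReal.ofReal_ne_top hF
  exact ⟨inferInstance, hint, (hpower hint).1 hF⟩

theorem IsCapacityAchieving.isMaxOn {P : ℝ} {F : ProbabilityMeasure ℂ}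
    (hF : IsCapacityAchieving σ b₁ b₂ q P F) :
    IsMaxOn (mutualInformation σ b₁ b₂ q) (admissibleInputs P) F := fun G hG => by
  rw [mem_ofPred_eq, ← EReal.coe_le_coe_iff, hF.2]
  exact le_iSup₂ (f := fun H (_ : H ∈ admissibleInputs P) =>
    (mutualInformation σ b₁ b₂ q H : EReal)) G hG

theorem IsCapacityAchieving.isMaxOn_mutualInfoNats (hσ : σ ≠ 0) (hq : IsThresholds b₂ q) {P : ℝ}
    (hP : 0 ≤ P) {F : ProbabilityMeasure ℂ} (hF : IsCapacityAchieving σ b₁ b₂ q P F) :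
    IsMaxOn (mutualInfoNats (quantizedChannel (receivedLaw σ 0) (polarCell b₁ b₂ q)))
      (costConstrainedInputs (fun u => ‖u‖ ^ 2) P) F := fun G hG => by
  obtain ⟨G, rfl⟩ : ∃ G' : ProbabilityMeasure ℂ, (G' : Measure ℂ) = G := ⟨⟨G, hG.1⟩, rfl⟩
  have hle : mutualInformation σ b₁ b₂ q G ≤ mutualInformation σ b₁ b₂ q F :=
    hF.isMaxOn ((mem_admissibleInputs_iff hP).2 hG)
  rw [mutualInformation_eq_mutualInfoNats_div hσ hq,
    mutualInformation_eq_mutualInfoNats_div hσ hq,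
    div_le_div_iff_of_pos_right (Real.log_pos one_lt_two)] at hle
  exact hle

end PolarQuantizedGaussianChannel

end PolarQuantization

end

open PolarQuantization

theorem mainTheorem3 (b₁ b₂ : ℕ) (hb : 0 < b₁ + b₂) (σ : ℝ) (hσ : 0 < σ)
    (q : Fin (2 ^ b₂ + 1) → ENNReal) (hq : PolarQuantization.IsThresholds b₂ q)
    (P' : ℝ) (hP' : 0 ≤ P') (F : MeasureTheory.ProbabilityMeasure ℂ)
    (hF : PolarQuantization.IsCapacityAchieving σ b₁ b₂ q P' F) :
    Bornology.IsBounded (F : MeasureTheory.Measure ℂ).support := by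
  have := isProbabilityMeasure_receivedLaw hσ.ne' 0
  have := isOpenPosMeasure_receivedLaw hσ.ne' 0
  have : Nontrivial (Fin (2 ^ b₁) × Fin (2 ^ b₂)) := by
    rw [← Fintype.one_lt_card_iff_nontrivial, Fintype.card_prod, Fintype.card_fin,
      Fintype.card_fin, ← pow_add]
    exact Nat.one_lt_two_pow hb.ne'
  have hcell (y : Fin (2 ^ b₁) × Fin (2 ^ b₂)) : Bornology.IsBounded (polarCell b₁ b₂ q y) ∨
      ∀ R, ∃ u, Metric.ball u R ⊆ polarCell b₁ b₂ q y :=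
    (ne_or_eq (q y.2.succ) ⊤).imp isBounded_polarCell (exists_ball_subset_polarCell hq.strictMono)
  have hcoercive : Filter.Tendsto (fun u : ℂ => ‖u‖ ^ 2) (Bornology.cobounded ℂ) Filter.atTop :=
    (Filter.tendsto_pow_atTop two_ne_zero).comp tendsto_norm_cobounded_atTop
  exact isBounded_support_of_isMaxOn_quantizedChannel (isQuantizer_polarCell hq) hcell
    (by fun_prop) hcoercive ((mem_admissibleInputs_iff hP').1 hF.1)
    (hF.isMaxOn_mutualInfoNats hσ.ne' hq hP')
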